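/- Let $d=2r$ with $r\ge 1$ an integer, let $\sigma_0=\frac1r\sum_{j=0}^{r-1}|j\rangle\langle j|$ and $\sigma_1=\frac1r\sum_{j=r}^{2r-1}|j\rangle\langle j|$ be states on $\mathbb C^d$, and let $\mathsf Q_d$ be the rank-$d/2$ Haar-measure encryption of one bit: the key is a unitary $U\in\mathcal U(d)$ drawn from the Haar probability measure, and the bit $m$ is encrypted as $U\sigma_mU^*$. A telegraphing-distinguishing attack consists of a finite-dimensional Hilbert space $B$, a measurement channel $\Phi:\mathcal B(\mathbb C^d)\to\mathcal B(B)$, i.e. $\Phi(\rho)=\sum_{x\in X}\mathrm{Tr}[P_x\rho]\,|e_x\rangle\langle e_x|$ for a finite POVM $\{P_x\}_{x\in X}$ on $\mathbb C^d$ and orthonormal vectors $e_x\in B$, and for each key $U$ a POVM $\{P^U_0,P^U_1\}$ on $B$ (such that the integrand below is measurable in $U$). Its success probability is $$\int_{\mathcal U(d)}\frac12\sum_{m\in\{0,1\}}\mathrm{Tr}\big[P^U_m\,\Phi(U\sigma_mU^*)\big]\,dU ,$$ and the telegraphing-distinguishing value $\mathfrak c^2_{1\to1}(\mathsf Q_d|\mathscr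 M)$ is the supremum of this quantity over all such attacks. Then $$\mathfrak c^2_{1\to1}(\mathsf Q_d|\mathscr M)\le\frac12+\frac1{2\sqrt{d+1}} .$$ Consequently the scheme is strongly untelegraphable-indistinguishable secure: if $(d_\lambda)_{\lambda\in\mathbb N}$ is a sequence of positive even integers such that $1/d_\lambda$ is negligible (decays faster than every inverse polynomial in $\lambda$; e.g. $d_\lambda=2^{\lambda+1}$), then there is a negligible function $\eta$ with $\mathfrak c^2_{1\to1}(\mathsf Q_{d_\lambda}|\mathscr M)\le\frac12+\eta(\lambda)$ for every $\lambda$. -/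

import Mathlib

open scoped ComplexOrder

/-! Finite-dimensional Hilbert spaces are `ℂ^A` for a finite register `A`; operators on `ℂ^A` are
matrices indexed by `A`. -/

namespace Telegraph

/-- A density operator: positive semidefinite with unit trace. -/
structure IsState {A : Type} [Fintype A] (ρ : Matrix A A ℂ) : Prop where
  posSemidef : ρ.PosSemidef
  trace_eq_one : ρ.trace = 1

/-- A POVM: a finite family of positive semidefinite operators summing to the identity. -/
structure IsPOVM {ι A : Type} [Fintype ι] [Fintype A] [DecidableEq A]
    (P : ι → Matrix A A ℂ) : Prop where
  posSemidef : ∀ i, (P i).PosSemidef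
  sum_eq_one : ∑ i, P i = 1

/-- Complete positivity: `Φ ⊗ id_k` maps positive semidefinite operators on `ℂ^A ⊗ ℂ^k` to
positive semidefinite operators on `ℂ^B ⊗ ℂ^k`, for every `k`. -/
def IsCompletelyPositive {A B : Type} [Fintype A] [Fintype B]
    (Φ : Matrix A A ℂ →ₗ[ℂ] Matrix B B ℂ) : Prop :=
  ∀ (k : ℕ) (R : Matrix (A × Fin k) (A × Fin k) ℂ), R.PosSemidef →
    (Matrix.of fun p q : B × Fin k =>
      Φ (Matrix.of fun a a' : A => R (a, p.2) (a', q.2)) p.1 q.1).PosSemidef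

/-- A quantum channel: completely positive and trace preserving. -/
structure IsQuantumChannel {A B : Type} [Fintype A] [Fintype B]
    (Φ : Matrix A A ℂ →ₗ[ℂ] Matrix B B ℂ) : Prop where
  completelyPositive : IsCompletelyPositive Φ
  trace_preserving : ∀ ρ, (Φ ρ).trace = ρ.trace

/-- A collection of maps between operator spaces, for all finite input and output registers. -/
abbrev ChannelClass : Type 1 :=
  ∀ ⦃A B : Type⦄ [Fintype A] [DecidableEq A] [Fintype B] [DecidableEq B],
    (Matrix A A ℂ →ₗ[ℂ] Matrix B B ℂ) → Prop

/-- The measurement (quantum-to-classical) channels: `Φ(ρ) = ∑ₓ Tr[Pₓ ρ] |eₓ⟩⟨eₓ|` for a POVM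
`(Pₓ)` and orthonormal vectors `(eₓ)` of the output space. -/
def measurementChannels : ChannelClass := fun A B _ _ _ _ Φ =>
  ∃ (X : Type) (_ : Fintype X) (P : X → Matrix A A ℂ) (e : X → EuclideanSpace ℂ B),
    IsPOVM P ∧ Orthonormal ℂ e ∧
      ∀ ρ, Φ ρ = ∑ x, (P x * ρ).trace • Matrix.vecMulVec (e x).ofLp (star (e x).ofLp)

/-- A quantum encryption of classical messages. -/
structure QECM where
  /-- the set of messages -/
  Msg : Type
  [fintypeMsg : Fintype Msg]
  /-- the set of keys -/
  Key : Type
  [measurableKey : MeasurableSpace Key]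
  /-- the key distribution -/
  keyDist : MeasureTheory.Measure Key
  [isProbability : MeasureTheory.IsProbabilityMeasure keyDist]
  /-- the register of the codespace -/
  Code : Type
  [fintypeCode : Fintype Code]
  [decEqCode : DecidableEq Code]
  /-- the ciphertexts -/
  cipher : Key → Msg → Matrix Code Code ℂ
  isState_cipher : ∀ k m, IsState (cipher k m)

attribute [instance] QECM.fintypeMsg QECM.measurableKey QECM.isProbability QECM.fintypeCode
  QECM.decEqCode

/-- A `1`-to-`1` `N`-message cloning attack over `F` against `Q`. The last field says that the
integral defining the success probability makes sense. -/
structure Attack (Q : QECM) (N : ℕ) (F : ChannelClass) where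
  /-- the set of `N` challenge messages -/
  msgs : Finset Q.Msg
  card_msgs : msgs.card = N
  /-- the register of the receiver -/
  Out : Type
  [fintypeOut : Fintype Out]
  [decEqOut : DecidableEq Out]
  /-- the receiver's measurement, depending on the key -/
  povm : Q.Key → msgs → Matrix Out Out ℂ
  isPOVM_povm : ∀ k, IsPOVM (povm k)
  /-- the channel applied to the ciphertext, without the key -/
  channel : Matrix Q.Code Q.Code ℂ →ₗ[ℂ] Matrix Out Out ℂ
  isQuantumChannel : IsQuantumChannel channel
  channel_mem : F channel
  aemeasurable_win : AEMeasurable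
    (fun k => (1 / (N : ℝ)) * ∑ m : msgs, (povm k m * channel (Q.cipher k m)).trace.re) Q.keyDist

attribute [instance] Attack.fintypeOut Attack.decEqOut

/-- The success (cloning) probability of an attack. The traces are real. -/
noncomputable def Attack.prob {Q : QECM} {N : ℕ} {F : ChannelClass} (𝒜 : Attack Q N F) : ℝ :=
  ∫ k, (1 / (N : ℝ)) *
    ∑ m : 𝒜.msgs, (𝒜.povm k m * 𝒜.channel (Q.cipher k m)).trace.re ∂Q.keyDist

/-- The `1`-to-`1` `N`-message cloning value over `F`: the supremum of the success probabilities
of all attacks, taken in the extended reals. -/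
noncomputable def QECM.cloningValue (Q : QECM) (N : ℕ) (F : ChannelClass) : EReal :=
  ⨆ 𝒜 : Attack Q N F, (𝒜.prob : EReal)

/-- The (one-copy) telegraphing-distinguishing value. -/
noncomputable def QECM.telegraphingDistinguishingValue (Q : QECM) : EReal :=
  Q.cloningValue 2 measurementChannels

/-- `ε`-untelegraphable-indistinguishable security. -/
def QECM.IsUntelegraphableIndistinguishable (Q : QECM) (ε : ℝ) : Prop :=
  Q.telegraphingDistinguishingValue ≤ ((1 / 2 + ε : ℝ) : EReal)

/-- A negligible function of the security parameter. -/
def Negligible (η : ℕ → ℝ) : Prop :=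
  Asymptotics.SuperpolynomialDecay Filter.atTop (fun l : ℕ => (l : ℝ)) η

/-- Strong untelegraphable-indistinguishable security of a family of schemes. -/
def IsStronglyUntelegraphableIndistinguishable (Q : ℕ → QECM) : Prop :=
  ∃ η : ℕ → ℝ, Negligible η ∧ ∀ l, (Q l).IsUntelegraphableIndistinguishable (η l)

noncomputable instance unitaryMeasurableSpace (d : ℕ) : MeasurableSpace (Matrix.unitaryGroup (Fin d) ℂ) :=
  borel _

instance unitaryBorelSpace (d : ℕ) : BorelSpace (Matrix.unitaryGroup (Fin d) ℂ) := ⟨rfl⟩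

instance unitaryCompactSpace (d : ℕ) : CompactSpace (Matrix.unitaryGroup (Fin d) ℂ) := by
  have hclosed : IsClosed {U : Matrix (Fin d) (Fin d) ℂ | U * star U = 1} :=
    isClosed_eq (by fun_prop) continuous_const
  have hcpt : IsCompact (Set.univ.pi fun _ : Fin d => Set.univ.pi fun _ : Fin d =>
      Metric.closedBall (0 : ℂ) 1) :=
    isCompact_univ_pi fun _ => isCompact_univ_pi fun _ => isCompact_closedBall 0 1
  have hset : ((Matrix.unitaryGroup (Fin d) ℂ : Submonoid (Matrix (Fin d) (Fin d) ℂ)) :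
      Set (Matrix (Fin d) (Fin d) ℂ)) = {U | U * star U = 1} := by
    ext U
    exact Matrix.mem_unitaryGroup_iff
  refine isCompact_iff_compactSpace.mp (hcpt.of_isClosed_subset (hset ▸ hclosed) ?_)
  intro U hU i _ j _
  simpa using entry_norm_bound_of_unitary hU i j

/-- The Haar probability measure on the unitary group. -/
noncomputable def haarUnitary (d : ℕ) :
    MeasureTheory.Measure (Matrix.unitaryGroup (Fin d) ℂ) :=
  MeasureTheory.Measure.haarMeasure ⊤

instance haarUnitary_isProbability (d : ℕ) :
    MeasureTheory.IsProbabilityMeasure (haarUnitary d) :=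
  ⟨MeasureTheory.Measure.haarMeasure_self⟩

/-- The state `σᵢ = (1/r) ∑_{j = ri}^{r(i+1)-1} |j⟩⟨j|` on `ℂ^{rn}`. -/
noncomputable def blockState (r n : ℕ) (i : Fin n) : Matrix (Fin (r * n)) (Fin (r * n)) ℂ :=
  Matrix.diagonal fun j => if r * i ≤ j ∧ (j : ℕ) < r * (i + 1) then 1 / (r : ℂ) else 0

theorem isState_blockState (r n : ℕ) (hr : 0 < r) (i : Fin n) : IsState (blockState r n i) := by
  constructor
  · refine Matrix.PosSemidef.diagonal fun j => ?_
    show (0 : ℂ) ≤ if _ then _ else _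
    split_ifs
    · simp
    · exact le_rfl
  · have hle : r * (i + 1) ≤ r * n := Nat.mul_le_mul_left r i.2
    have hr' : (r : ℂ) ≠ 0 := by exact_mod_cast hr.ne'
    rw [blockState, Matrix.trace_diagonal,
      Fin.sum_univ_eq_sum_range
        (fun j => if r * i ≤ j ∧ j < r * (i + 1) then 1 / (r : ℂ) else 0) (r * n),
      ← Finset.sum_filter]
    have : (Finset.range (r * n)).filter (fun j => r * i ≤ j ∧ j < r * (i + 1)) =
        Finset.Ico (r * i) (r * (i + 1)) := by
      ext j
      simp only [Finset.mem_filter, Finset.mem_range, Finset.mem_Ico]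
      omega
    rw [this, Finset.sum_const, Nat.card_Ico, mul_add, mul_one, Nat.add_sub_cancel_left,
      nsmul_eq_mul, mul_one_div_cancel hr']

theorem IsState.conj {d : ℕ} {ρ : Matrix (Fin d) (Fin d) ℂ} (h : IsState ρ)
    (U : Matrix.unitaryGroup (Fin d) ℂ) : IsState (U.1 * ρ * star U.1) := by
  constructor
  · exact h.posSemidef.mul_mul_conjTranspose_same U.1
  · rw [Matrix.trace_mul_comm, ← mul_assoc, Matrix.mem_unitaryGroup_iff'.mp U.2, one_mul,
      h.trace_eq_one]

/-- The rank-`r` Haar-measure encryption of `n` messages: the key is a Haar-random unitary `U` on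
`ℂ^{rn}`, and the message `i` is encrypted as `U σᵢ U*`. -/
noncomputable def haarEncryption (r n : ℕ) (hr : 0 < r) : QECM where
  Msg := Fin n
  Key := Matrix.unitaryGroup (Fin (r * n)) ℂ
  keyDist := haarUnitary (r * n)
  Code := Fin (r * n)
  cipher U i := U.1 * blockState r n i * star U.1
  isState_cipher U i := (isState_blockState r n hr i).conj U

end Telegraph

namespace Telegraph

open MeasureTheory Matrix

instance haarUnitary_isHaarMeasure (d : ℕ) : (haarUnitary d).IsHaarMeasure := by
  unfold haarUnitary
  infer_instance

/-- The unitary group is compact, hence unimodular. -/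
instance haarUnitary_isMulRightInvariant (d : ℕ) : (haarUnitary d).IsMulRightInvariant where
  map_mul_right_eq_self g := by
    have : IsProbabilityMeasure ((haarUnitary d).map (· * g)) :=
      Measure.isProbabilityMeasure_map (by fun_prop)
    exact Measure.isHaarMeasure_eq_of_isProbabilityMeasure _ _

theorem integrable_haarUnitary {d : ℕ} {f : unitaryGroup (Fin d) ℂ → ℝ} (hf : Continuous f) :
    Integrable f (haarUnitary d) :=
  hf.integrable_of_hasCompactSupport (HasCompactSupport.of_compactSpace f)

theorem continuous_unitary_entry {d : ℕ} (i j : Fin d) :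
    Continuous fun U : unitaryGroup (Fin d) ℂ => U.1 i j :=
  (continuous_subtype_val).matrix_elem i j

/-- Every unit vector is a column of a unitary matrix. -/
theorem exists_unitary_col_eq {d : ℕ} (w : Fin d → ℂ) (hw : ∑ k, ‖w k‖ ^ 2 = 1) (j : Fin d) :
    ∃ V : unitaryGroup (Fin d) ℂ, ∀ k, V.1 k j = w k := by
  have hunit : ‖(WithLp.toLp 2 w : EuclideanSpace ℂ (Fin d))‖ = 1 := by
    simp [EuclideanSpace.norm_eq, hw]
  have horth : Orthonormal ℂ (({j} : Set (Fin d)).domRestrict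
      fun _ => (WithLp.toLp 2 w : EuclideanSpace ℂ (Fin d))) := by
    refine ⟨fun _ => hunit, fun a b hab => ?_⟩
    exact absurd (Subsingleton.elim a b) hab
  obtain ⟨b, hb⟩ := horth.exists_orthonormalBasis_extension_of_card_eq (by simp)
  refine ⟨⟨_, (EuclideanSpace.basisFun (Fin d) ℂ).toMatrix_orthonormalBasis_mem_unitary b⟩,
    fun k => ?_⟩
  simp [Module.Basis.toMatrix_apply, hb j rfl]

theorem integral_norm_row_dot_pow_four {d : ℕ} (i j : Fin d) (w : Fin d → ℂ)
    (hw : ∑ k, ‖w k‖ ^ 2 = 1) :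
    ∫ U : unitaryGroup (Fin d) ℂ, ‖∑ k, U.1 i k * w k‖ ^ 4 ∂haarUnitary d =
      ∫ U : unitaryGroup (Fin d) ℂ, ‖U.1 i j‖ ^ 4 ∂haarUnitary d := by
  obtain ⟨V, hV⟩ := exists_unitary_col_eq w hw j
  rw [← integral_mul_right_eq_self (fun U : unitaryGroup (Fin d) ℂ => ‖U.1 i j‖ ^ 4) V]
  simp [Matrix.mul_apply, hV]

theorem norm_pow_four_phase_average (a b : ℂ) :
    ‖a + b‖ ^ 4 + ‖a - b‖ ^ 4 + ‖a + Complex.I * b‖ ^ 4 + ‖a - Complex.I * b‖ ^ 4 =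
      4 * ‖a‖ ^ 4 + 4 * ‖b‖ ^ 4 + 16 * (‖a‖ ^ 2 * ‖b‖ ^ 2) := by
  have h : ∀ z : ℂ, ‖z‖ ^ 4 = (z.re * z.re + z.im * z.im) ^ 2 := fun z => by
    rw [← Complex.normSq_apply, ← Complex.sq_norm]; ring
  simp only [h, Complex.sq_norm, Complex.normSq_apply]
  simp
  ring

/-- Mixed fourth moments of two entries in a row of a Haar unitary. -/
theorem two_mul_integral_norm_sq_mul_norm_sq {d : ℕ} (i : Fin d) {j k : Fin d} (hjk : j ≠ k) :
    2 * ∫ U : unitaryGroup (Fin d) ℂ, ‖U.1 i j‖ ^ 2 * ‖U.1 i k‖ ^ 2 ∂haarUnitary d =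
      ∫ U : unitaryGroup (Fin d) ℂ, ‖U.1 i j‖ ^ 4 ∂haarUnitary d := by
  have hc := fun j : Fin d => continuous_unitary_entry i j
  have hphase : ∀ ω : ℂ, ‖ω‖ = 1 →
      ∫ U : unitaryGroup (Fin d) ℂ, ‖U.1 i j + ω * U.1 i k‖ ^ 4 ∂haarUnitary d =
        4 * ∫ U : unitaryGroup (Fin d) ℂ, ‖U.1 i j‖ ^ 4 ∂haarUnitary d := by
    intro ω hω
    have hs : ((Real.sqrt 2)⁻¹) ^ 2 = (1 / 2 : ℝ) := by
      rw [inv_pow, Real.sq_sqrt (by norm_num)]; norm_num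
    have hw : ∑ l, ‖(Pi.single j ((Real.sqrt 2)⁻¹ : ℂ) + Pi.single k (ω * (Real.sqrt 2)⁻¹ : ℂ) :
        Fin d → ℂ) l‖ ^ 2 = 1 := by
      rw [← Finset.add_sum_erase _ _ (Finset.mem_univ j),
        ← Finset.add_sum_erase _ _ (Finset.mem_erase.2 ⟨hjk.symm, Finset.mem_univ k⟩),
        Finset.sum_eq_zero]
      · simp [hjk, hjk.symm, hω]
        norm_num
      · intro l hl
        simp only [Finset.mem_erase] at hl
        simp [hl.1, hl.2.1]
    rw [← integral_norm_row_dot_pow_four i j _ hw, ← integral_const_mul]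
    congr 1
    ext U
    have : ∑ l, U.1 i l * (Pi.single j ((Real.sqrt 2)⁻¹ : ℂ) +
        Pi.single k (ω * (Real.sqrt 2)⁻¹ : ℂ) : Fin d → ℂ) l =
        (U.1 i j + ω * U.1 i k) * ((Real.sqrt 2)⁻¹ : ℝ) := by
      simp [mul_add, Finset.sum_add_distrib, Pi.single_apply]
      ring
    rw [this, norm_mul, mul_pow, Complex.norm_real, Real.norm_eq_abs,
      show |(Real.sqrt 2)⁻¹| ^ 4 = (|(Real.sqrt 2)⁻¹| ^ 2) ^ 2 by ring, sq_abs, hs]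
    ring
  have hsymm : ∫ U : unitaryGroup (Fin d) ℂ, ‖U.1 i k‖ ^ 4 ∂haarUnitary d =
      ∫ U : unitaryGroup (Fin d) ℂ, ‖U.1 i j‖ ^ 4 ∂haarUnitary d := by
    rw [← integral_norm_row_dot_pow_four i j (Pi.single k 1)]
    · simp [Pi.single_apply]
    · rw [Finset.sum_eq_single k] <;> simp +contextual
  have hI : ∀ ω : ℂ, Integrable (fun U : unitaryGroup (Fin d) ℂ => ‖U.1 i j + ω * U.1 i k‖ ^ 4)
      (haarUnitary d) := fun ω => integrable_haarUnitary
    (((hc j).add (continuous_const.mul (hc k))).norm.pow 4)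
  have h4 : ∀ l, Integrable (fun U : unitaryGroup (Fin d) ℂ => ‖U.1 i l‖ ^ 4)
      (haarUnitary d) := fun l => integrable_haarUnitary ((hc l).norm.pow 4)
  have h22 : Integrable (fun U : unitaryGroup (Fin d) ℂ => ‖U.1 i j‖ ^ 2 * ‖U.1 i k‖ ^ 2)
      (haarUnitary d) := integrable_haarUnitary (((hc j).norm.pow 2).mul ((hc k).norm.pow 2))
  have key := integral_congr_ae (μ := haarUnitary d) (Filter.Eventually.of_forall
    fun U : unitaryGroup (Fin d) ℂ => norm_pow_four_phase_average (U.1 i j) (U.1 i k))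
  have e1 := hphase 1 (by simp)
  have e2 := hphase (-1) (by simp)
  have e3 := hphase Complex.I (by simp)
  have e4 := hphase (-Complex.I) (by simp)
  have i1 := hI 1
  have i2 := hI (-1)
  have i3 := hI Complex.I
  have i4 := hI (-Complex.I)
  simp only [one_mul, neg_mul, ← sub_eq_add_neg] at e1 e2 e3 e4 i1 i2 i3 i4
  rw [integral_add ((i1.fun_add i2).fun_add i3) i4, integral_add (i1.fun_add i2) i3, integral_add i1 i2,
    integral_add (((h4 j).const_mul 4).fun_add ((h4 k).const_mul 4)) (h22.const_mul 16),
    integral_add ((h4 j).const_mul 4) ((h4 k).const_mul 4), integral_const_mul, integral_const_mul,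
    integral_const_mul, e1, e2, e3, e4, hsymm] at key
  linarith

theorem sum_norm_sq_row {d : ℕ} (U : unitaryGroup (Fin d) ℂ) (i : Fin d) :
    ∑ j, ‖U.1 i j‖ ^ 2 = 1 := by
  have h := congrFun (congrFun (Matrix.mem_unitaryGroup_iff.1 U.2) i) i
  rw [Matrix.mul_apply, Matrix.one_apply_eq] at h
  have h' : ((∑ j, ‖U.1 i j‖ ^ 2 : ℝ) : ℂ) = 1 := by
    rw [← h]
    push_cast
    refine Finset.sum_congr rfl fun j _ => ?_
    rw [Matrix.star_apply, Complex.star_def, Complex.mul_conj, Complex.normSq_eq_norm_sq]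
    push_cast
    rfl
  exact_mod_cast h'

/-- The second moment of a quadratic form in the absolute values of a row, in terms of the
fourth moment of one entry. -/
theorem integral_sum_mul_norm_sq_sq {d : ℕ} (i : Fin d) (s : Fin d → ℝ) :
    ∫ U : unitaryGroup (Fin d) ℂ, (∑ j, s j * ‖U.1 i j‖ ^ 2) ^ 2 ∂haarUnitary d =
      ((∑ j, s j) ^ 2 + ∑ j, s j ^ 2) / 2 *
        ∫ U : unitaryGroup (Fin d) ℂ, ‖U.1 i i‖ ^ 4 ∂haarUnitary d := by
  set M := ∫ U : unitaryGroup (Fin d) ℂ, ‖U.1 i i‖ ^ 4 ∂haarUnitary d with hM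
  have hc := fun j : Fin d => continuous_unitary_entry i j
  have hdiag : ∀ j, ∫ U : unitaryGroup (Fin d) ℂ, ‖U.1 i j‖ ^ 4 ∂haarUnitary d = M := by
    intro j
    rw [hM, ← integral_norm_row_dot_pow_four i i (Pi.single j 1)]
    · simp [Pi.single_apply]
    · rw [Finset.sum_eq_single j] <;> simp +contextual
  have hmom : ∀ j k, ∫ U : unitaryGroup (Fin d) ℂ, ‖U.1 i j‖ ^ 2 * ‖U.1 i k‖ ^ 2 ∂haarUnitary d =
      M / 2 + if j = k then M / 2 else 0 := by
    intro j k
    split_ifs with h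
    · subst h
      rw [add_halves, ← hdiag j]
      congr 1; ext U; ring
    · have := two_mul_integral_norm_sq_mul_norm_sq i h
      rw [hdiag] at this
      linarith
  have hexp : ∀ U : unitaryGroup (Fin d) ℂ, (∑ j, s j * ‖U.1 i j‖ ^ 2) ^ 2 =
      ∑ j, ∑ k, s j * s k * (‖U.1 i j‖ ^ 2 * ‖U.1 i k‖ ^ 2) := by
    intro U
    rw [sq, Finset.sum_mul_sum]
    exact Finset.sum_congr rfl fun j _ => Finset.sum_congr rfl fun k _ => by ring
  have hint : ∀ j k, Integrable (fun U : unitaryGroup (Fin d) ℂ =>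
      s j * s k * (‖U.1 i j‖ ^ 2 * ‖U.1 i k‖ ^ 2)) (haarUnitary d) := fun j k =>
    (integrable_haarUnitary (((hc j).norm.pow 2).mul ((hc k).norm.pow 2))).const_mul _
  simp_rw [hexp]
  rw [integral_finsetSum _ fun j _ => integrable_finsetSum _ fun k _ => hint j k]
  simp_rw [integral_finsetSum Finset.univ fun k _ => hint _ k, integral_const_mul, hmom, mul_add,
    Finset.sum_add_distrib]
  simp only [mul_ite, mul_zero, Finset.sum_ite_eq, Finset.mem_univ, if_true]
  rw [add_div, add_mul, sq (∑ j, s j), Finset.sum_mul_sum, Finset.sum_div, Finset.sum_mul,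
    Finset.sum_div, Finset.sum_mul]
  congr 1
  · refine Finset.sum_congr rfl fun j _ => ?_
    rw [Finset.sum_div, Finset.sum_mul]
    exact Finset.sum_congr rfl fun k _ => by ring
  · exact Finset.sum_congr rfl fun j _ => by ring

theorem integral_norm_entry_pow_four {d : ℕ} (i : Fin d) :
    ∫ U : unitaryGroup (Fin d) ℂ, ‖U.1 i i‖ ^ 4 ∂haarUnitary d = 2 / (d * (d + 1)) := by
  have h := integral_sum_mul_norm_sq_sq i fun _ => 1
  simp only [one_mul, sum_norm_sq_row] at h
  have hd : (0 : ℝ) < d := by exact_mod_cast i.pos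
  simp at h
  rw [eq_div_iff (by positivity)]
  linarith

theorem integral_abs_sum_sign_mul_norm_sq_le {d : ℕ} (i : Fin d) (s : Fin d → ℝ)
    (hs : ∀ j, s j ^ 2 = 1) (hsum : ∑ j, s j = 0) :
    ∫ U : unitaryGroup (Fin d) ℂ, |∑ j, s j * ‖U.1 i j‖ ^ 2| ∂haarUnitary d ≤
      1 / Real.sqrt (d + 1) := by
  have hc : Continuous fun U : unitaryGroup (Fin d) ℂ => ∑ j, s j * ‖U.1 i j‖ ^ 2 :=
    continuous_finsetSum _ fun j _ =>
      continuous_const.mul ((continuous_unitary_entry i j).norm.pow 2)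
  have hd : (0 : ℝ) < d := by exact_mod_cast i.pos
  have hsq : ∫ U : unitaryGroup (Fin d) ℂ, (∑ j, s j * ‖U.1 i j‖ ^ 2) ^ 2 ∂haarUnitary d =
      1 / (d + 1) := by
    rw [integral_sum_mul_norm_sq_sq, integral_norm_entry_pow_four, hsum]
    simp [hs]
    field_simp
  have hint : Integrable (fun U : unitaryGroup (Fin d) ℂ => (∑ j, s j * ‖U.1 i j‖ ^ 2) ^ 2)
      (haarUnitary d) := integrable_haarUnitary (hc.pow 2)
  set c := Real.sqrt (d + 1) with hcdef
  have hcpos : 0 < c := Real.sqrt_pos.2 (by positivity)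
  have hc2 : c ^ 2 = d + 1 := Real.sq_sqrt (by positivity)
  calc _ ≤ ∫ U : unitaryGroup (Fin d) ℂ,
        (c / 2 * (∑ j, s j * ‖U.1 i j‖ ^ 2) ^ 2 + 1 / (2 * c)) ∂haarUnitary d := by
        refine integral_mono (integrable_haarUnitary hc.abs)
          ((hint.const_mul _).add (integrable_const _)) fun U => ?_
        simp only
        rw [← sq_abs (∑ j, s j * ‖U.1 i j‖ ^ 2)]
        generalize |∑ j, s j * ‖U.1 i j‖ ^ 2| = x
        have : c / 2 * x ^ 2 + 1 / (2 * c) - x = (c * x - 1) ^ 2 / (2 * c) := by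
          field_simp; ring
        have : 0 ≤ (c * x - 1) ^ 2 / (2 * c) := by positivity
        linarith
    _ = 1 / c := by
        rw [integral_add (hint.const_mul _) (integrable_const _),
          integral_const_mul, hsq, ← hc2]
        simp
        field_simp
        norm_num

theorem trace_diagonal_mul_conj_diagonal {d : ℕ} (U : Matrix (Fin d) (Fin d) ℂ)
    (a s : Fin d → ℝ) :
    (diagonal (fun i => (a i : ℂ)) * (U * diagonal (fun j => (s j : ℂ)) * star U)).trace =
      ((∑ i, a i * ∑ j, s j * ‖U i j‖ ^ 2 : ℝ) : ℂ) := by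
  simp only [Matrix.trace, Matrix.diag, Matrix.diagonal_mul]
  push_cast
  refine Finset.sum_congr rfl fun i _ => ?_
  rw [Matrix.mul_apply]
  congr 1
  refine Finset.sum_congr rfl fun j _ => ?_
  rw [Matrix.mul_diagonal, Matrix.star_apply, Complex.star_def, mul_right_comm, Complex.mul_conj,
    Complex.normSq_eq_norm_sq]
  push_cast
  ring

/-- A Haar-random traceless reflection is nearly orthogonal to any fixed positive operator. -/
theorem integral_abs_trace_mul_conj_sign_le {d : ℕ} {P : Matrix (Fin d) (Fin d) ℂ}
    (hP : P.PosSemidef) (s : Fin d → ℝ) (hs : ∀ j, s j ^ 2 = 1) (hsum : ∑ j, s j = 0) :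
    ∫ U : unitaryGroup (Fin d) ℂ,
        |(P * (U.1 * diagonal (fun j => (s j : ℂ)) * star U.1)).trace.re| ∂haarUnitary d ≤
      P.trace.re / Real.sqrt (d + 1) := by
  set V := hP.1.eigenvectorUnitary
  set a := hP.1.eigenvalues
  have hspec : P = V.1 * diagonal (fun i => (a i : ℂ)) * star V.1 := by
    have := hP.1.spectral_theorem
    rwa [Unitary.conjStarAlgAut_apply] at this
  have hV : star V.1 * V.1 = 1 := Matrix.mem_unitaryGroup_iff'.1 V.2
  have htr : P.trace.re = ∑ i, a i := by
    rw [hP.1.trace_eq_sum_eigenvalues]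
    simp [a]
  have hc : ∀ i, Continuous fun U : unitaryGroup (Fin d) ℂ => ∑ j, s j * ‖U.1 i j‖ ^ 2 :=
    fun i => continuous_finsetSum _ fun j _ =>
      continuous_const.mul ((continuous_unitary_entry i j).norm.pow 2)
  rw [← integral_mul_left_eq_self _ V]
  have hpt : ∀ U : unitaryGroup (Fin d) ℂ,
      (P * ((V * U).1 * diagonal (fun j => (s j : ℂ)) * star (V * U).1)).trace.re =
        ∑ i, a i * ∑ j, s j * ‖U.1 i j‖ ^ 2 := by
    intro U
    have h : (P * ((V * U).1 * diagonal (fun j => (s j : ℂ)) * star (V * U).1)).trace =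
        (diagonal (fun i => (a i : ℂ)) *
          (U.1 * diagonal (fun j => (s j : ℂ)) * star U.1)).trace := by
      have e : P * ((V * U).1 * diagonal (fun j => (s j : ℂ)) * star (V * U).1) =
          V.1 * (diagonal (fun i => (a i : ℂ)) * (star V.1 * V.1) *
            (U.1 * diagonal (fun j => (s j : ℂ)) * star U.1) * star V.1) := by
        conv_lhs => rw [hspec]
        rw [show (V * U).1 = V.1 * U.1 from rfl, star_mul]
        simp only [mul_assoc]
      rw [e, hV, Matrix.trace_mul_comm, mul_assoc, hV, mul_one, mul_one]
    rw [h, trace_diagonal_mul_conj_diagonal, Complex.ofReal_re]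
  simp_rw [hpt]
  calc _ ≤ ∫ U : unitaryGroup (Fin d) ℂ,
        ∑ i, a i * |∑ j, s j * ‖U.1 i j‖ ^ 2| ∂haarUnitary d := by
        refine integral_mono (integrable_haarUnitary ?_) (integrable_haarUnitary ?_) fun U => ?_
        · exact (continuous_finsetSum _ fun i _ => continuous_const.mul (hc i)).abs
        · exact continuous_finsetSum _ fun i _ => continuous_const.mul (hc i).abs
        · refine (Finset.abs_sum_le_sum_abs _ _).trans_eq (Finset.sum_congr rfl fun i _ => ?_)
          rw [abs_mul, abs_of_nonneg (hP.eigenvalues_nonneg i)]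
    _ = ∑ i, a i * ∫ U : unitaryGroup (Fin d) ℂ,
        |∑ j, s j * ‖U.1 i j‖ ^ 2| ∂haarUnitary d := by
        rw [integral_finsetSum _ fun i _ => (integrable_haarUnitary (hc i).abs).const_mul _]
        simp_rw [integral_const_mul]
    _ ≤ ∑ i, a i * (1 / Real.sqrt (d + 1)) := Finset.sum_le_sum fun i _ =>
        mul_le_mul_of_nonneg_left (integral_abs_sum_sign_mul_norm_sq_le i s hs hsum)
          (hP.eigenvalues_nonneg i)
    _ = P.trace.re / Real.sqrt (d + 1) := by
        rw [← Finset.sum_mul, htr, mul_one_div]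

theorem trace_mul_vecMulVec_star {B : Type} [Fintype B] (Q : Matrix B B ℂ) (v : B → ℂ) :
    (Q * vecMulVec v (star v)).trace = star v ⬝ᵥ (Q *ᵥ v) := by
  rw [Matrix.mul_vecMulVec, Matrix.trace_vecMulVec, dotProduct_comm]

open scoped MatrixOrder in
theorem trace_mul_nonneg {A : Type} [Fintype A] [DecidableEq A] {P ρ : Matrix A A ℂ}
    (hP : P.PosSemidef) (hρ : ρ.PosSemidef) : 0 ≤ (P * ρ).trace := by
  obtain ⟨C, rfl⟩ := CStarAlgebra.nonneg_iff_eq_star_mul_self.1 hρ.nonneg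
  rw [← mul_assoc, Matrix.trace_mul_comm, ← mul_assoc]
  exact (hP.mul_mul_conjTranspose_same C).trace_nonneg

/-- The receiver guessing between two states from a classical outcome does no better than the
outcome-wise optimal guess. -/
theorem trace_add_trace_measurement_bounds {A B X : Type} [Fintype A] [DecidableEq A] [Fintype B]
    [DecidableEq B] [Fintype X] {P : X → Matrix A A ℂ} (hP : IsPOVM P)
    {e : X → EuclideanSpace ℂ B} (he : Orthonormal ℂ e)
    {Φ : Matrix A A ℂ → Matrix B B ℂ}
    (hΦ : ∀ ρ, Φ ρ = ∑ x, (P x * ρ).trace • vecMulVec (e x).ofLp (star (e x).ofLp))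
    {Q₀ Q₁ : Matrix B B ℂ} (hQ₀ : Q₀.PosSemidef) (hQ₁ : Q₁.PosSemidef) (hQ : Q₀ + Q₁ = 1)
    {ρ₀ ρ₁ : Matrix A A ℂ} (hρ₀ : IsState ρ₀) (hρ₁ : IsState ρ₁) :
    0 ≤ (Q₀ * Φ ρ₀).trace.re + (Q₁ * Φ ρ₁).trace.re ∧
    (Q₀ * Φ ρ₀).trace.re + (Q₁ * Φ ρ₁).trace.re ≤
      1 + 1 / 2 * ∑ x, |(P x * (ρ₀ - ρ₁)).trace.re| := by
  have hexp : ∀ {Q ρ}, Q.PosSemidef → IsState ρ → (Q * Φ ρ).trace.re =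
      ∑ x, (P x * ρ).trace.re * (star (e x).ofLp ⬝ᵥ (Q *ᵥ (e x).ofLp)).re := by
    intro Q ρ hQ hρ
    rw [hΦ, Matrix.mul_sum, Matrix.trace_sum, Complex.re_sum]
    refine Finset.sum_congr rfl fun x _ => ?_
    rw [Matrix.mul_smul, Matrix.trace_smul, trace_mul_vecMulVec_star, smul_eq_mul, Complex.mul_re,
      ← (Complex.nonneg_iff.1 (trace_mul_nonneg (hP.posSemidef x) hρ.posSemidef)).2, zero_mul,
      sub_zero]
  have hsum : ∀ {ρ}, IsState ρ → ∑ x, (P x * ρ).trace.re = 1 := by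
    intro ρ hρ
    rw [← Complex.re_sum, ← Matrix.trace_sum, ← Finset.sum_mul, hP.sum_eq_one, one_mul,
      hρ.trace_eq_one, Complex.one_re]
  have hnn : ∀ {Q : Matrix B B ℂ}, Q.PosSemidef → ∀ x,
      0 ≤ (star (e x).ofLp ⬝ᵥ (Q *ᵥ (e x).ofLp)).re := fun hQ x =>
    (Complex.nonneg_iff.1 (hQ.dotProduct_mulVec_nonneg _)).1
  have hone : ∀ x, (star (e x).ofLp ⬝ᵥ (Q₀ *ᵥ (e x).ofLp)).re +
      (star (e x).ofLp ⬝ᵥ (Q₁ *ᵥ (e x).ofLp)).re = 1 := by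
    intro x
    rw [← Complex.add_re, ← dotProduct_add, ← Matrix.add_mulVec, hQ, Matrix.one_mulVec,
      dotProduct_comm, ← EuclideanSpace.inner_eq_star_dotProduct, inner_self_eq_norm_sq_to_K,
      he.1 x]
    simp
  rw [hexp hQ₀ hρ₀, hexp hQ₁ hρ₁]
  constructor
  · exact add_nonneg
      (Finset.sum_nonneg fun x _ => mul_nonneg
        (Complex.nonneg_iff.1 (trace_mul_nonneg (hP.posSemidef x) hρ₀.posSemidef)).1 (hnn hQ₀ x))
      (Finset.sum_nonneg fun x _ => mul_nonneg
        (Complex.nonneg_iff.1 (trace_mul_nonneg (hP.posSemidef x) hρ₁.posSemidef)).1 (hnn hQ₁ x))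
  · have h1 : (1 : ℝ) = ∑ x, ((P x * ρ₀).trace.re + (P x * ρ₁).trace.re) / 2 := by
      rw [← Finset.sum_div, Finset.sum_add_distrib, hsum hρ₀, hsum hρ₁]
      norm_num
    rw [← Finset.sum_add_distrib, h1, Finset.mul_sum, ← Finset.sum_add_distrib]
    refine Finset.sum_le_sum fun x _ => ?_
    rw [Matrix.mul_sub, Matrix.trace_sub, Complex.sub_re]
    have h0 := hnn hQ₀ x
    have h1 := hnn hQ₁ x
    have h2 := hone x
    generalize (star (e x).ofLp ⬝ᵥ (Q₀ *ᵥ (e x).ofLp)).re = p at *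
    generalize (star (e x).ofLp ⬝ᵥ (Q₁ *ᵥ (e x).ofLp)).re = q at *
    generalize (P x * ρ₀).trace.re = a
    generalize (P x * ρ₁).trace.re = b
    obtain rfl : q = 1 - p := by linarith
    rcases abs_cases (a - b) with ⟨h, h'⟩ | ⟨h, h'⟩ <;> rw [h] <;> nlinarith

/-- The sign of the block of the index `j` of `ℂ^{2r}`. -/
noncomputable def blockSign (r : ℕ) (j : Fin (r * 2)) : ℝ := if (j : ℕ) < r then 1 else -1

theorem blockSign_sq (r : ℕ) (j : Fin (r * 2)) : blockSign r j ^ 2 = 1 := by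
  unfold blockSign
  split_ifs <;> norm_num

theorem sum_blockSign (r : ℕ) : ∑ j, blockSign r j = 0 := by
  unfold blockSign
  rw [Fin.sum_univ_eq_sum_range (fun j => if j < r then (1 : ℝ) else -1) (r * 2), mul_two,
    Finset.sum_range_add]
  rw [Finset.sum_congr rfl fun j hj => if_pos (Finset.mem_range.1 hj),
    Finset.sum_congr rfl fun j _ => if_neg (by omega)]
  simp

theorem blockState_sub (r : ℕ) :
    blockState r 2 0 - blockState r 2 1 =
      (1 / (r : ℂ)) • diagonal (fun j => (blockSign r j : ℂ)) := by
  rw [blockState, blockState, Matrix.diagonal_sub, ← Matrix.diagonal_smul]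
  congr 1
  ext j
  have hj := j.2
  by_cases h : (j : ℕ) < r
  · have : ¬ r ≤ (j : ℕ) := by omega
    simp [blockSign, h, this]
  · have h1 : r ≤ (j : ℕ) := by omega
    have h2 : (j : ℕ) < r * (1 + 1) := by omega
    simp [blockSign, h, h1, h2]

theorem sum_subtype_of_card_eq_two {s : Finset (Fin 2)} (hs : s.card = 2) :
    ∃ (h0 : 0 ∈ s) (h1 : 1 ∈ s), ∀ {M : Type} [AddCommMonoid M] (f : s → M),
      ∑ m : s, f m = f ⟨0, h0⟩ + f ⟨1, h1⟩ := by
  obtain rfl : s = Finset.univ := Finset.eq_univ_of_card s (by simpa using hs)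
  refine ⟨Finset.mem_univ _, Finset.mem_univ _, fun f => ?_⟩
  rw [← Fin.sum_univ_two fun i : Fin 2 => f ⟨i, Finset.mem_univ i⟩]
  exact (Fintype.sum_equiv (Equiv.subtypeUnivEquiv fun i => Finset.mem_univ i).symm _ _
    fun i => rfl).symm

/-- The success probability of guessing the block of a Haar-random encryption from the outcome of
a measurement, when the key is revealed after the measurement. -/
theorem integral_guess_le (r : ℕ) (hr : 0 < r) {B X : Type} [Fintype B] [DecidableEq B]
    [Fintype X] {P : X → Matrix (Fin (r * 2)) (Fin (r * 2)) ℂ} (hP : IsPOVM P)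
    {e : X → EuclideanSpace ℂ B} (he : Orthonormal ℂ e)
    {Φ : Matrix (Fin (r * 2)) (Fin (r * 2)) ℂ → Matrix B B ℂ}
    (hΦ : ∀ ρ, Φ ρ = ∑ x, (P x * ρ).trace • vecMulVec (e x).ofLp (star (e x).ofLp))
    {Q₀ Q₁ : unitaryGroup (Fin (r * 2)) ℂ → Matrix B B ℂ} (hQ₀ : ∀ U, (Q₀ U).PosSemidef)
    (hQ₁ : ∀ U, (Q₁ U).PosSemidef) (hQ : ∀ U, Q₀ U + Q₁ U = 1) :
    ∫ U, 1 / 2 * ((Q₀ U * Φ (U.1 * blockState r 2 0 * star U.1)).trace.re +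
        (Q₁ U * Φ (U.1 * blockState r 2 1 * star U.1)).trace.re) ∂haarUnitary (r * 2) ≤
      1 / 2 + 1 / (2 * Real.sqrt (((2 * r : ℕ) : ℝ) + 1)) := by
  have hr' : (0 : ℝ) < r := by exact_mod_cast hr
  let g : X → unitaryGroup (Fin (r * 2)) ℂ → ℝ := fun x U =>
    |(P x * (U.1 * diagonal (fun j => (blockSign r j : ℂ)) * star U.1)).trace.re|
  have hg : ∀ x, Integrable (g x) (haarUnitary (r * 2)) := by
    intro x
    refine integrable_haarUnitary ?_
    have hU : Continuous fun U : unitaryGroup (Fin (r * 2)) ℂ => U.1 := continuous_subtype_val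
    have hM : Continuous fun U : unitaryGroup (Fin (r * 2)) ℂ =>
        P x * (U.1 * diagonal (fun j => (blockSign r j : ℂ)) * star U.1) :=
      continuous_const.matrix_mul ((hU.matrix_mul continuous_const).matrix_mul hU.star)
    exact (Complex.continuous_re.comp hM.matrix_trace).abs
  have hdiff : ∀ x (U : unitaryGroup (Fin (r * 2)) ℂ), |(P x * (U.1 * blockState r 2 0 * star U.1 -
      U.1 * blockState r 2 1 * star U.1)).trace.re| = 1 / r * g x U := by
    intro x U
    rw [← sub_mul, ← mul_sub, blockState_sub, Matrix.mul_smul, Matrix.smul_mul, Matrix.mul_smul,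
      Matrix.trace_smul, smul_eq_mul, show (1 / (r : ℂ)) = ((1 / r : ℝ) : ℂ) by push_cast; rfl,
      Complex.re_ofReal_mul, abs_mul, abs_of_pos (by positivity)]
  have hbounds := fun U : unitaryGroup (Fin (r * 2)) ℂ =>
    trace_add_trace_measurement_bounds hP he hΦ (hQ₀ U) (hQ₁ U) (hQ U)
      ((isState_blockState r 2 hr 0).conj U) ((isState_blockState r 2 hr 1).conj U)
  simp only [hdiff, ← Finset.mul_sum] at hbounds
  have htrace : ∑ x, (P x).trace.re = 2 * r := by
    rw [← Complex.re_sum, ← Matrix.trace_sum, hP.sum_eq_one, Matrix.trace_one, Fintype.card_fin,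
      Complex.natCast_re]
    push_cast
    ring
  have hI : Integrable (fun U => ∑ x, g x U) (haarUnitary (r * 2)) :=
    integrable_finsetSum _ fun x _ => hg x
  calc _ ≤ ∫ U, (1 / 2 + 1 / (4 * r) * ∑ x, g x U) ∂haarUnitary (r * 2) := by
        refine integral_mono_of_nonneg (Filter.Eventually.of_forall fun U => ?_)
          ((integrable_const _).add (hI.const_mul _)) (Filter.Eventually.of_forall fun U => ?_)
        · exact mul_nonneg (by norm_num) (hbounds U).1
        · refine (mul_le_mul_of_nonneg_left (hbounds U).2 (by norm_num)).trans_eq ?_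
          ring
    _ = 1 / 2 + 1 / (4 * r) * ∑ x, ∫ U, g x U ∂haarUnitary (r * 2) := by
        rw [integral_add (integrable_const _) (hI.const_mul _), integral_const_mul,
          integral_finsetSum _ fun x _ => hg x]
        simp
    _ ≤ 1 / 2 + 1 / (4 * r) * ∑ x, (P x).trace.re / Real.sqrt ((r * 2 : ℕ) + 1) := by
        gcongr with x
        exact integral_abs_trace_mul_conj_sign_le (hP.posSemidef x) _ (blockSign_sq r)
          (sum_blockSign r)
    _ = 1 / 2 + 1 / (2 * Real.sqrt (((2 * r : ℕ) : ℝ) + 1)) := by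
        rw [← Finset.sum_div, htrace, mul_comm r 2]
        field_simp
        ring

theorem prob_haarEncryption_le (r : ℕ) (hr : 0 < r)
    (𝒜 : Attack (haarEncryption r 2 hr) 2 measurementChannels) :
    𝒜.prob ≤ 1 / 2 + 1 / (2 * Real.sqrt (((2 * r : ℕ) : ℝ) + 1)) := by
  obtain ⟨X, _, P, e, hP, he, hΦ⟩ := 𝒜.channel_mem
  obtain ⟨h0, h1, hsum⟩ := sum_subtype_of_card_eq_two 𝒜.card_msgs
  refine le_trans (le_of_eq ?_) (integral_guess_le r hr hP he hΦ
    (Q₀ := fun U => 𝒜.povm U ⟨(0 : Fin 2), h0⟩) (Q₁ := fun U => 𝒜.povm U ⟨(1 : Fin 2), h1⟩)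
    (fun U => (𝒜.isPOVM_povm U).posSemidef _) (fun U => (𝒜.isPOVM_povm U).posSemidef _)
    fun U => (hsum _).symm.trans (𝒜.isPOVM_povm U).sum_eq_one)
  refine integral_congr_ae (Filter.Eventually.of_forall fun U => ?_)
  exact congrArg₂ (· * ·) (by norm_num) (hsum _)

theorem negligible_inv_two_mul_sqrt {d : ℕ → ℕ} (h : Negligible fun l => 1 / (d l : ℝ))
    (hd : ∀ l, 0 < d l) : Negligible fun l => 1 / (2 * Real.sqrt ((d l : ℝ) + 1)) := by
  intro n
  have hlim : Filter.Tendsto (fun l : ℕ => Real.sqrt ((l : ℝ) ^ (2 * n) * (1 / (d l : ℝ))))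
      Filter.atTop (nhds 0) := by
    simpa using (h (2 * n)).sqrt
  refine squeeze_zero (fun l => by positivity) (fun l => ?_) hlim
  have hdl : (0 : ℝ) < d l := by exact_mod_cast hd l
  rw [Real.sqrt_mul (by positivity), mul_comm 2 n, pow_mul, Real.sqrt_sq (by positivity),
    Real.sqrt_div (by norm_num), Real.sqrt_one]
  refine mul_le_mul_of_nonneg_left (one_div_le_one_div_of_le (Real.sqrt_pos.2 hdl) ?_)
    (by positivity)
  have : Real.sqrt (d l) ≤ Real.sqrt (d l + 1) := Real.sqrt_le_sqrt (by linarith)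
  have := Real.sqrt_nonneg (d l + 1)
  linarith

theorem telegraphingDistinguishingValue_haarEncryption_le (r : ℕ) (hr : 0 < r) :
    (haarEncryption r 2 hr).telegraphingDistinguishingValue ≤
      ((1 / 2 + 1 / (2 * Real.sqrt (((2 * r : ℕ) : ℝ) + 1)) : ℝ) : EReal) :=
  iSup_le fun 𝒜 => EReal.coe_le_coe_iff.2 (prob_haarEncryption_le r hr 𝒜)

end Telegraph

theorem mainTheorem1 :
    (∀ (d r : ℕ) (hr : 0 < r), d = 2 * r →
      (Telegraph.haarEncryption r 2 hr).telegraphingDistinguishingValue ≤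
        ((1 / 2 + 1 / (2 * Real.sqrt ((d : ℝ) + 1)) : ℝ) : EReal)) ∧
    (∀ (d r : ℕ → ℕ) (hr : ∀ l, 0 < r l), (∀ l, d l = 2 * r l) →
      Telegraph.Negligible (fun l => 1 / (d l : ℝ)) →
        Telegraph.IsStronglyUntelegraphableIndistinguishable
          (fun l => Telegraph.haarEncryption (r l) 2 (hr l))) := by
  refine ⟨?_, ?_⟩
  · rintro _ r hr rfl
    exact Telegraph.telegraphingDistinguishingValue_haarEncryption_le r hr
  · intro d r hr hd hneg
    refine ⟨_, Telegraph.negligible_inv_two_mul_sqrt hneg fun l => ?_, fun l => ?_⟩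
    · rw [hd]; exact Nat.mul_pos two_pos (hr l)
    · rw [hd]
      exact Telegraph.telegraphingDistinguishingValue_haarEncryption_le (r l) (hr l)
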